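/- Let $\mathfrak{g}$ be a symmetrizable Kac--Moody algebra over $\mathbb{C}$ with indecomposable generalized Cartan matrix $(a_{ij})_{i,j\in\mathbf{I}}$ ($\mathbf{I}$ finite), and let $(\mathfrak{h},\{\alpha_i\},\{\alpha_i^\vee\})$ be a realization of it: $\{\alpha_i\}\subset\mathfrak{h}^*$ and $\{\alpha_i^\vee\}\subset\mathfrak{h}$ are linearly independent, $\alpha_j(\alpha_i^\vee)=a_{ij}$, and $\dim\mathfrak{h}=2|\mathbf{I}|-\operatorname{rank}(a_{ij})$. Let $d_i$ be the relatively prime positive integers with $d_ia_{ij}=d_ja_{ji}$, and put $d_{ij}=\tfrac12 d_ia_{ij}$. The Yangian $Y_\hbar\mathfrak{g}$ is the unital associative $\mathbb{C}[\hbar]$-algebra generated by (the vector space) $\mathfrak{h}$ and symbols $x_{ir}^\pm,h_{ir}$ ($i\in\mathbf{I}$, $r\in\mathbb{N}=\{0,1,2,\dots\}$), subject to the relations, for all $i,j\in\mathbf{I}$, $h,h'\in\mathfrak{h}$ and all mode indices $r,s,r_1,\dots,r_m$: $$h_{i0}=d_i\alpha_i^\vee,\quad [h_{ir},h_{js}]=[h_{ir},h]=[h,h']=0,\quad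 [h,x_{js}^\pm]=\pm\alpha_j(h)x_{js}^\pm,\quad [x_{ir}^+,x_{js}^-]=\delta_{ij}h_{i,r+s},$$ $$[h_{i,r+1},x_{js}^\pm]-[h_{ir},x_{j,s+1}^\pm]=\pm\hbar d_{ij}(h_{ir}x_{js}^\pm+x_{js}^\pm h_{ir}),$$ $$[x_{i,r+1}^\pm,x_{js}^\pm]-[x_{ir}^\pm,x_{j,s+1}^\pm]=\pm\hbar d_{ij}(x_{ir}^\pm x_{js}^\pm+x_{js}^\pm x_{ir}^\pm),$$ $$\sum_{\pi\in S_m}\bigl[x_{i,r_{\pi(1)}}^\pm,\bigl[x_{i,r_{\pi(2)}}^\pm,\cdots,[x_{i,r_{\pi(m)}}^\pm,x_{js}^\pm]\cdots\bigr]\bigr]=0\qquad(i\ne j,\ m=1-a_{ij}).$$ Let $\mathbb{D}Y_\hbar\mathfrak{g}$ be the $\mathbb{C}[\hbar]$-algebra generated by $\mathfrak{h}$ and symbols $\mathcal{X}_{ir}^\pm,\mathcal{H}_{ir}$ ($i\in\mathbf{I}$, $r\in\mathbb{Z}$) subject to the same relations with all mode indices ranging over $\mathbb{Z}$ (and $x,h$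 replaced by $\mathcal{X},\mathcal{H}$). Let $\mathrm{D}Y_\hbar\mathfrak{g}$, the Yangian double, be the $\mathbb{C}[[\hbar]]$-algebra topologically generated by the same generators and relations, i.e. the quotient of $\mathbb{C}\langle\text{generators}\rangle[[\hbar]]$ by the $\hbar$-adic closure of the two-sided ideal generated by the relations. Finally, let $Y_\hbar\mathfrak{b}^\pm\subset Y_\hbar\mathfrak{g}$ be the $\mathbb{C}[\hbar]$-subalgebra generated by $\mathfrak{h}$ and $\{x_{ir}^\pm,h_{ir}\}_{i\in\mathbf{I},r\in\mathbb{N}}$. Then: 1. The natural $\mathbb{C}[\hbar]$-algebra homomorphism $\imath:Y_\hbar\mathfrak{g}\to\mathbb{D}Y_\hbar\mathfrak{g}$, given by $x_{ir}^\pm\mapsto\mathcal{X}_{ir}^\pm$, $h_{ir}\mapsto\mathcal{H}_{ir}$, $h\mapsto h$, and its composite $Y_\hbar\mathfrak{g}\to\mathbb{D}Y_\hbar\mathfrak{g}\to\mathrm{D}Y_\hbar\mathfrak{g}$ with the natural homomorphism, are both injective. 2. For each $i\in\mathbf{I}$ and each choice of sign, the assignment $$x_{jr}^\pm\mapsto x_{j,r+\delta_{ij}}^\pm,\qquad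 h_{jr}\mapsto h_{jr},\qquad h\mapsto h\qquad(j\in\mathbf{I},\ r\in\mathbb{N},\ h\in\mathfrak{h})$$ extends uniquely to a $\mathbb{C}[\hbar]$-algebra endomorphism of $Y_\hbar\mathfrak{b}^\pm$, and this endomorphism is injective. -/

import Mathlib

open scoped Polynomial PowerSeries

noncomputable section

namespace KacMoodyYangian

universe u v

/-- The data attached to a symmetrizable Kac-Moody algebra with Cartan subalgebra `𝔥` and
indecomposable generalized Cartan matrix `A`: the matrix, the symmetrizing integers `d i`
(the half square lengths `(α i, α i) / 2` in the normalized invariant form) and a realization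
`(𝔥, α, α^∨)` of `A` over `ℂ`. -/
structure Datum (I : Type u) (𝔥 : Type v) [Fintype I] [AddCommGroup 𝔥] [Module ℂ 𝔥] where
  /-- the generalized Cartan matrix -/
  A : Matrix I I ℤ
  diag : ∀ i, A i i = 2
  offDiag_nonpos : ∀ i j, i ≠ j → A i j ≤ 0
  zero_iff : ∀ i j, A i j = 0 ↔ A j i = 0
  /-- `A` is indecomposable -/
  indecomposable : ∀ S : Set I, S.Nonempty → Sᶜ.Nonempty → ∃ i ∈ S, ∃ j ∈ Sᶜ, A i j ≠ 0
  /-- the symmetrizing integers -/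
  d : I → ℕ
  d_pos : ∀ i, 0 < d i
  /-- the `d i` are relatively prime; in particular there is at least one index -/
  d_gcd : Finset.univ.gcd d = 1
  symmetrizes : ∀ i j, (d i : ℤ) * A i j = d j * A j i
  /-- simple roots -/
  root : I → Module.Dual ℂ 𝔥
  /-- simple coroots -/
  coroot : I → 𝔥
  root_linearIndependent : LinearIndependent ℂ root
  coroot_linearIndependent : LinearIndependent ℂ coroot
  root_coroot : ∀ i j, root j (coroot i) = (A i j : ℂ)
  /-- `dim 𝔥 = 2 |I| - rank A`; since `I` is not empty, this makes `𝔥` finite-dimensional -/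
  dim_eq : Module.finrank ℂ 𝔥 + (A.map (Int.cast : ℤ → ℂ)).rank = 2 * Fintype.card I

/-- Symbols for the generators, with mode index in `R` (`R = ℕ` for the Yangian and `R = ℤ` for its
double): `car h` for `h ∈ 𝔥`, `x ε i r` for `x_{ir}^±` (where `ε = ±1`), and `h i r` for `h_{ir}`. -/
inductive Gen (I : Type u) (𝔥 : Type v) (R : Type) : Type (max u v)
  | car (h : 𝔥)
  | x (ε : ℤˣ) (i : I) (r : R)
  | h (i : I) (r : R)

section Relations

variable {I : Type u} {𝔥 : Type v} [Fintype I] [DecidableEq I] [AddCommGroup 𝔥] [Module ℂ 𝔥]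

/-- `d_{ij} = (α i, α j) / 2`, where `(α i, α j) = d i * a_{ij}`. -/
def Datum.dd (D : Datum I 𝔥) (i j : I) : ℂ := (D.d i : ℂ) * (D.A i j : ℂ) / 2

/-- The sign `±1` as a complex number. -/
def sgn (ε : ℤˣ) : ℂ := ((ε : ℤ) : ℂ)

/-- The iterated commutator `[y 0, [y 1, …, [y (m - 1), z] …]]`. -/
def iterBracket {E : Type*} [Ring E] {m : ℕ} (y : Fin m → E) (z : E) : E :=
  (List.ofFn y).foldr (fun a b => ⁅a, b⁆) z

/-- The defining relations `lhs = rhs`, for elements `g` of a `ℂ`-algebra `E` labelled by the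
generators, and with deformation parameter `ħ ∈ E`. The mode indices range over `R`; for `R = ℤ`
these are the coefficients of the relations between generating series which define the double. -/
inductive Rel (D : Datum I 𝔥) {R : Type} [Semiring R] {E : Type*} [Ring E] [Algebra ℂ E]
    (ħ : E) (g : Gen I 𝔥 R → E) : E → E → Prop
  /-- `𝔥` is embedded linearly. -/
  | car_add (h h' : 𝔥) : Rel D ħ g (g (.car (h + h'))) (g (.car h) + g (.car h'))
  | car_smul (c : ℂ) (h : 𝔥) : Rel D ħ g (g (.car (c • h))) (c • g (.car h))
  /-- `h_{i0} = d_i α_i^∨` -/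
  | h_zero (i : I) : Rel D ħ g (g (.h i 0)) (g (.car ((D.d i : ℂ) • D.coroot i)))
  | h_h (i j : I) (r s : R) : Rel D ħ g ⁅g (.h i r), g (.h j s)⁆ 0
  | h_car (i : I) (r : R) (h : 𝔥) : Rel D ħ g ⁅g (.h i r), g (.car h)⁆ 0
  | car_car (h h' : 𝔥) : Rel D ħ g ⁅g (.car h), g (.car h')⁆ 0
  | car_x (h : 𝔥) (ε : ℤˣ) (j : I) (s : R) :
      Rel D ħ g ⁅g (.car h), g (.x ε j s)⁆ ((sgn ε * D.root j h) • g (.x ε j s))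
  | x_x (i j : I) (r s : R) :
      Rel D ħ g ⁅g (.x 1 i r), g (.x (-1) j s)⁆ (if i = j then g (.h i (r + s)) else 0)
  | h_x (ε : ℤˣ) (i j : I) (r s : R) :
      Rel D ħ g (⁅g (.h i (r + 1)), g (.x ε j s)⁆ - ⁅g (.h i r), g (.x ε j (s + 1))⁆)
        ((sgn ε * D.dd i j) • (ħ * (g (.h i r) * g (.x ε j s) + g (.x ε j s) * g (.h i r))))
  | x_x_same (ε : ℤˣ) (i j : I) (r s : R) :
      Rel D ħ g (⁅g (.x ε i (r + 1)), g (.x ε j s)⁆ - ⁅g (.x ε i r), g (.x ε j (s + 1))⁆)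
        ((sgn ε * D.dd i j) • (ħ * (g (.x ε i r) * g (.x ε j s) + g (.x ε j s) * g (.x ε i r))))
  /-- Serre relations, with `m = 1 - a_{ij}` -/
  | serre (ε : ℤˣ) (i j : I) (hij : i ≠ j) (r : Fin (1 - D.A i j).toNat → R) (s : R) :
      Rel D ħ g (∑ π : Equiv.Perm (Fin (1 - D.A i j).toNat),
        iterBracket (fun k => g (.x ε i (r (π k)))) (g (.x ε j s))) 0

theorem map_lie' {E E' : Type*} [Ring E] [Ring E'] [Algebra ℂ E] [Algebra ℂ E']
    (f : E →ₐ[ℂ] E') (a b : E) : f ⁅a, b⁆ = ⁅f a, f b⁆ := by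
  simp [Ring.lie_def]

theorem map_iterBracket {E E' : Type*} [Ring E] [Ring E'] [Algebra ℂ E] [Algebra ℂ E']
    (f : E →ₐ[ℂ] E') {m : ℕ} (y : Fin m → E) (z : E) :
    f (iterBracket y z) = iterBracket (fun k => f (y k)) (f z) := by
  have key : ∀ l : List E, f (l.foldr (fun a b => ⁅a, b⁆) z)
      = (l.map f).foldr (fun a b => ⁅a, b⁆) (f z) := by
    intro l
    induction l with
    | nil => rfl
    | cons a l ih => simp only [List.foldr_cons, List.map_cons, map_lie', ih]
  unfold iterBracket
  rw [key, List.map_ofFn]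
  rfl

/-- Reindexing of generators along a map of mode indices. -/
def Gen.mapMode {R R' : Type} (φ : R → R') : Gen I 𝔥 R → Gen I 𝔥 R'
  | .car y => .car y
  | .x ε i r => .x ε i (φ r)
  | .h i r => .h i (φ r)

/-- The relations are preserved by algebra homomorphisms and by homomorphisms of mode indices. -/
theorem Rel.map {D : Datum I 𝔥} {R R' : Type} [Semiring R] [Semiring R'] (φ : R →+* R')
    {E E' : Type*} [Ring E] [Ring E'] [Algebra ℂ E] [Algebra ℂ E'] (f : E →ₐ[ℂ] E')
    {ħ : E} {ħ' : E'} {g : Gen I 𝔥 R → E} {g' : Gen I 𝔥 R' → E'} (hħ : f ħ = ħ')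
    (hg : ∀ a, f (g a) = g' (a.mapMode φ)) {a b : E} (hab : Rel D ħ g a b) :
    Rel D ħ' g' (f a) (f b) := by
  cases hab <;>
    simp only [map_lie', map_add, map_sub, map_mul, map_smul, map_zero, map_sum,
      map_iterBracket, apply_ite f, hg, hħ, Gen.mapMode, map_one]
  case car_add => exact .car_add _ _
  case car_smul => exact .car_smul _ _
  case h_zero => exact .h_zero _
  case h_h => exact .h_h _ _ _ _
  case h_car => exact .h_car _ _ _
  case car_car => exact .car_car _ _
  case car_x => exact .car_x _ _ _ _
  case x_x => exact .x_x _ _ _ _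
  case h_x => exact .h_x _ _ _ _ _
  case x_x_same => exact .x_x_same _ _ _ _ _
  case serre ε i j hij r s => exact .serre ε i j hij (fun k => φ (r k)) _

/-- The `ℂ[ħ]`-algebra with generators `Gen I 𝔥 R` and the relations above (`ħ` is the polynomial
variable). -/
abbrev PolyAlg (D : Datum I 𝔥) (R : Type) [Semiring R] : Type (max u v) :=
  RingQuot (Rel D (algebraMap ℂ[X] (FreeAlgebra ℂ[X] (Gen I 𝔥 R)) Polynomial.X)
    (FreeAlgebra.ι ℂ[X]))

/-- The generators in `PolyAlg D R`. -/
def PolyAlg.gen (D : Datum I 𝔥) {R : Type} [Semiring R] (a : Gen I 𝔥 R) : PolyAlg D R :=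
  RingQuot.mkAlgHom ℂ[X] _ (FreeAlgebra.ι ℂ[X] a)

/-- The Yangian `Y_ħ𝔤`. -/
abbrev Yangian (D : Datum I 𝔥) : Type (max u v) := PolyAlg D ℕ

/-- The `ℂ[ħ]`-form of the Yangian double. -/
abbrev DoubleForm (D : Datum I 𝔥) : Type (max u v) := PolyAlg D ℤ

/-- The natural map from the Yangian to the `ℂ[ħ]`-form of its double, which sends each generator
to the generator of the same name. -/
def toDoubleForm (D : Datum I 𝔥) : Yangian D →ₐ[ℂ[X]] DoubleForm D :=
  RingQuot.liftAlgHom ℂ[X]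
    ⟨(RingQuot.mkAlgHom ℂ[X] _).comp
      (FreeAlgebra.lift ℂ[X] fun a : Gen I 𝔥 ℕ =>
        FreeAlgebra.ι ℂ[X] (a.mapMode (Nat.castRingHom ℤ))), by
      intro a b hab
      simp only [AlgHom.comp_apply]
      refine RingQuot.mkAlgHom_rel ℂ[X] ?_
      refine Rel.map (Nat.castRingHom ℤ) (AlgHom.restrictScalars ℂ
        (FreeAlgebra.lift ℂ[X] fun a : Gen I 𝔥 ℕ =>
          FreeAlgebra.ι ℂ[X] (a.mapMode (Nat.castRingHom ℤ)))) ?_ ?_ hab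
      · exact AlgHom.commutes _ _
      · intro a
        simp⟩

theorem toDoubleForm_gen (D : Datum I 𝔥) (a : Gen I 𝔥 ℕ) :
    toDoubleForm D (PolyAlg.gen D a) = PolyAlg.gen D (a.mapMode (Nat.castRingHom ℤ)) := by
  simp [toDoubleForm, PolyAlg.gen, RingQuot.liftAlgHom_mkAlgHom_apply]

end Relations

section Topological

/-- The topologically free algebra `ℂ⟨X⟩⟦ħ⟧` on a set `X` (`ħ` is the power series variable). -/
def TopFree (X : Type u) : Type u := PowerSeries (FreeAlgebra ℂ X)

namespace TopFree

variable {X : Type u}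

instance : Ring (TopFree X) := inferInstanceAs (Ring (PowerSeries (FreeAlgebra ℂ X)))

instance : Algebra ℂ (TopFree X) := inferInstanceAs (Algebra ℂ (PowerSeries (FreeAlgebra ℂ X)))

/-- The formal parameter. -/
def hbar : TopFree X := (PowerSeries.X : PowerSeries (FreeAlgebra ℂ X))

/-- The elements of `X` inside `ℂ⟨X⟩⟦ħ⟧`. -/
def of (a : X) : TopFree X := (PowerSeries.C (FreeAlgebra.ι ℂ a) : PowerSeries (FreeAlgebra ℂ X))

/-- The structure map `ℂ⟦ħ⟧ → ℂ⟨X⟩⟦ħ⟧`. -/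
def scalar : ℂ⟦X⟧ →+* TopFree X := PowerSeries.map (algebraMap ℂ (FreeAlgebra ℂ X))

theorem scalar_comm (c : ℂ⟦X⟧) (f : TopFree X) : scalar c * f = f * scalar c := by
  suffices key : ∀ F : PowerSeries (FreeAlgebra ℂ X),
      PowerSeries.map (algebraMap ℂ (FreeAlgebra ℂ X)) c * F =
        F * PowerSeries.map (algebraMap ℂ (FreeAlgebra ℂ X)) c by
    exact key f
  intro F
  refine PowerSeries.ext fun n => ?_
  rw [PowerSeries.coeff_mul, PowerSeries.coeff_mul, ← Finset.Nat.sum_antidiagonal_swap]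
  refine Finset.sum_congr rfl fun p _ => ?_
  simp only [PowerSeries.coeff_map, Prod.fst_swap, Prod.snd_swap]
  exact Algebra.commutes _ _

instance : Algebra ℂ⟦X⟧ (TopFree X) := scalar.toAlgebra' scalar_comm

/-- The structure over `ℂ[ħ]`, by restriction from `ℂ⟦ħ⟧`. -/
instance : Algebra ℂ[X] (TopFree X) :=
  (scalar.comp (Polynomial.coeToPowerSeries.ringHom)).toAlgebra' fun c f => scalar_comm c f

theorem algebraMap_X : algebraMap ℂ[X] (TopFree X) Polynomial.X = hbar := by
  change PowerSeries.map (algebraMap ℂ (FreeAlgebra ℂ X)) ((Polynomial.X : ℂ[X]) : ℂ⟦X⟧) = _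
  rw [Polynomial.coe_X, PowerSeries.map_X]
  rfl

instance : IsScalarTower ℂ ℂ[X] (TopFree X) := by
  refine IsScalarTower.of_algebraMap_eq fun c => ?_
  change _ = PowerSeries.map (algebraMap ℂ (FreeAlgebra ℂ X))
    ((Polynomial.C c : ℂ[X]) : ℂ⟦X⟧)
  rw [Polynomial.coe_C, PowerSeries.map_C]
  exact PowerSeries.algebraMap_apply

theorem hbar_pow_comm (n : ℕ) (f : TopFree X) : hbar ^ n * f = f * hbar ^ n :=
  (PowerSeries.commute_X_pow (R := FreeAlgebra ℂ X) f n).symm.eq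

/-- The closure of a two-sided ideal of `ℂ⟨X⟩⟦ħ⟧` in the `ħ`-adic topology: `f` lies in the closure
if for each `n` it is congruent modulo `ħ ^ n` to an element of the ideal. -/
def closure (J : TwoSidedIdeal (TopFree X)) : TwoSidedIdeal (TopFree X) :=
  TwoSidedIdeal.mk' {f | ∀ n : ℕ, ∃ g ∈ J, ∃ k : TopFree X, f = g + hbar ^ n * k}
    (fun n => ⟨0, J.zero_mem, 0, by simp⟩)
    (fun {x y} hx hy n => by
      obtain ⟨g, hg, k, rfl⟩ := hx n
      obtain ⟨g', hg', k', rfl⟩ := hy n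
      exact ⟨g + g', J.add_mem hg hg', k + k', by rw [mul_add]; abel⟩)
    (fun {x} hx n => by
      obtain ⟨g, hg, k, rfl⟩ := hx n
      exact ⟨-g, J.neg_mem hg, -k, by rw [mul_neg]; abel⟩)
    (fun {x y} hy n => by
      obtain ⟨g, hg, k, rfl⟩ := hy n
      exact ⟨x * g, J.mul_mem_left _ _ hg, x * k, by
        rw [mul_add, ← mul_assoc, ← hbar_pow_comm, mul_assoc]⟩)
    (fun {x y} hx n => by
      obtain ⟨g, hg, k, rfl⟩ := hx n
      exact ⟨g * y, J.mul_mem_right _ _ hg, k * y, by rw [add_mul, mul_assoc]⟩)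

theorem le_closure {J : TwoSidedIdeal (TopFree X)} {f : TopFree X} (hf : f ∈ J) :
    f ∈ closure J := by
  rw [closure, TwoSidedIdeal.mem_mk']
  exact fun n => ⟨f, hf, 0, by simp⟩

end TopFree

variable {I : Type u} {𝔥 : Type v} [Fintype I] [DecidableEq I] [AddCommGroup 𝔥] [Module ℂ 𝔥]

/-- The two-sided ideal of `ℂ⟨X⟩⟦ħ⟧` generated by the relations of the Yangian double. -/
def doubleIdeal (D : Datum I 𝔥) : TwoSidedIdeal (TopFree (Gen I 𝔥 ℤ)) :=
  TwoSidedIdeal.span {f | ∃ a b, Rel D TopFree.hbar TopFree.of a b ∧ f = a - b}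

/-- The Yangian double `DY_ħ𝔤`: the `ℂ⟦ħ⟧`-algebra topologically generated by `Gen I 𝔥 ℤ` subject
to the relations, that is, the quotient of `ℂ⟨X⟩⟦ħ⟧` by the `ħ`-adic closure of the two-sided ideal
which the relations generate. It is an algebra over `ℂ⟦ħ⟧` and hence over `ℂ[ħ]`. -/
abbrev Double (D : Datum I 𝔥) : Type (max u v) :=
  (TopFree.closure (doubleIdeal D)).ringCon.Quotient

/-- The topological generators of the Yangian double. -/
def Double.gen (D : Datum I 𝔥) (a : Gen I 𝔥 ℤ) : Double D :=
  RingCon.mkₐ ℂ⟦X⟧ _ (TopFree.of a)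

/-- The natural map from the `ℂ[ħ]`-form of the Yangian double to the Yangian double. -/
def formToDouble (D : Datum I 𝔥) : DoubleForm D →ₐ[ℂ[X]] Double D :=
  RingQuot.liftAlgHom ℂ[X]
    ⟨(RingCon.mkₐ ℂ[X] (TopFree.closure (doubleIdeal D)).ringCon).comp
      (FreeAlgebra.lift ℂ[X] TopFree.of), by
      intro a b hab
      simp only [AlgHom.comp_apply]
      refine (RingCon.eq _).2 ((TwoSidedIdeal.rel_iff _ _ _).2
        (TopFree.le_closure (TwoSidedIdeal.subset_span ⟨_, _, ?_, rfl⟩)))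
      refine Rel.map (RingHom.id ℤ)
        (AlgHom.restrictScalars ℂ (FreeAlgebra.lift ℂ[X] TopFree.of)) ?_ ?_ hab
      · exact (AlgHom.commutes _ _).trans TopFree.algebraMap_X
      · intro a
        cases a <;> simp [Gen.mapMode]⟩

theorem formToDouble_gen (D : Datum I 𝔥) (a : Gen I 𝔥 ℤ) :
    formToDouble D (PolyAlg.gen D a) = Double.gen D a := by
  simp only [formToDouble, PolyAlg.gen, RingQuot.liftAlgHom_mkAlgHom_apply, AlgHom.comp_apply,
    FreeAlgebra.lift_ι_apply]
  rfl

/-- The natural map from the Yangian to its double. -/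
def toDouble (D : Datum I 𝔥) : Yangian D →ₐ[ℂ[X]] Double D :=
  (formToDouble D).comp (toDoubleForm D)

/-- The Borel subalgebras `Y_ħ𝔟^±` of the Yangian, for `ε = ±1`: the `ℂ[ħ]`-subalgebras generated by
`𝔥`, all `x_{ir}^±` with the given sign, and all `h_{ir}`. -/
def borel (D : Datum I 𝔥) (ε : ℤˣ) : Subalgebra ℂ[X] (Yangian D) :=
  Algebra.adjoin ℂ[X]
    ((Set.range fun h : 𝔥 => PolyAlg.gen D (.car h)) ∪
      (Set.range fun p : I × ℕ => PolyAlg.gen D (.x ε p.1 p.2)) ∪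
      Set.range fun p : I × ℕ => PolyAlg.gen D (.h p.1 p.2))

/-- `h ∈ 𝔥` as an element of a Borel subalgebra. -/
def borel.car (D : Datum I 𝔥) (ε : ℤˣ) (h : 𝔥) : borel D ε :=
  ⟨PolyAlg.gen D (.car h), Algebra.subset_adjoin (.inl (.inl ⟨h, rfl⟩))⟩

/-- `x_{jr}^±` as an element of the Borel subalgebra of the same sign. -/
def borel.x (D : Datum I 𝔥) (ε : ℤˣ) (j : I) (r : ℕ) : borel D ε :=
  ⟨PolyAlg.gen D (.x ε j r), Algebra.subset_adjoin (.inl (.inr ⟨(j, r), rfl⟩))⟩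

/-- `h_{jr}` as an element of a Borel subalgebra. -/
def borel.h (D : Datum I 𝔥) (ε : ℤˣ) (j : I) (r : ℕ) : borel D ε :=
  ⟨PolyAlg.gen D (.h j r), Algebra.subset_adjoin (.inr ⟨(j, r), rfl⟩)⟩

/-- `σ` acts on the generators of the Borel subalgebra as the shift at the index `i`:
`x_{jr}^± ↦ x_{j,r+δ_{ij}}^±`, `h_{jr} ↦ h_{jr}`, `h ↦ h`. -/
structure IsShift (D : Datum I 𝔥) (ε : ℤˣ) (i : I) (σ : borel D ε →ₐ[ℂ[X]] borel D ε) :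
    Prop where
  map_x : ∀ (j : I) (r : ℕ), σ (borel.x D ε j r) = borel.x D ε j (r + if i = j then 1 else 0)
  map_h : ∀ (j : I) (r : ℕ), σ (borel.h D ε j r) = borel.h D ε j r
  map_car : ∀ h : 𝔥, σ (borel.car D ε h) = borel.car D ε h

end Topological

end KacMoodyYangian

end

noncomputable section

namespace KacMoodyYangian

universe u v

/-! ### Presentations and their universal property. -/

section Presentation

variable {I : Type u} {𝔥 : Type v} [Fintype I] [DecidableEq I] [AddCommGroup 𝔥] [Module ℂ 𝔥]

/-! Think of the mode `r` as `u ^ r`. Substituting `u ↦ 1 + t u` turns `u ^ r` into the binomial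
series `∑ k, (r choose k) t ^ k u ^ k`, which makes sense for every integer `r` and uses only modes
`k ≥ 0`. Since `(1 + t u) - (1 + t v) = t (u - v)`, the relations survive if also `ħ ↦ t ħ`. So
every realization of the Yangian relations in `A` gives one of the double's relations in `A⟦t⟧`
(`Realizes.expand`). As `ħ` becomes divisible by `t`, the map kills the `ħ`-adic closure of the
relations as well (`topFreeEval_closure`), so it descends to the completed double.

Take `A` to be the Yangian itself. On the Yangian, where all modes are natural numbers, the
composite with `toDouble` has polynomial values in `t`, and at `t = -1` it becomes the substitution
`u ↦ 1 - u`, `ħ ↦ -ħ`, an involution. Hence the composite is injective (`injective_of_expand`), so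
`toDouble` is injective, and so is its first factor `toDoubleForm`.

For the Borel subalgebras, the modes in the double can be translated in both directions, so a
coweight acts by an invertible shift (`latticeShift`). The fundamental coweight at `i`, with the
appropriate sign, maps the embedded Borel subalgebra into itself; injectivity of `toDoubleForm`
carries this back to the Yangian. -/

/-- The elements `g` satisfy the defining relations. -/
def Realizes (D : Datum I 𝔥) {R : Type} [Semiring R] {E : Type*} [Ring E] [Algebra ℂ E]
    (ħ : E) (g : Gen I 𝔥 R → E) : Prop :=
  ∀ a b, Rel D ħ g a b → a = b

/-- The relations between the images of generators are the images of the relations. -/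
theorem Rel.exists_of_map {D : Datum I 𝔥} {R : Type} [Semiring R] {E E' : Type*} [Ring E] [Ring E']
    [Algebra ℂ E] [Algebra ℂ E'] (f : E →ₐ[ℂ] E') {ħ : E} {ħ' : E'} {g : Gen I 𝔥 R → E}
    {g' : Gen I 𝔥 R → E'} (hħ : f ħ = ħ') (hg : ∀ a, f (g a) = g' a) {a' b' : E'}
    (h : Rel D ħ' g' a' b') : ∃ a b, Rel D ħ g a b ∧ f a = a' ∧ f b = b' := by
  cases h
  case car_add h h' => exact ⟨_, _, .car_add h h', by simp [hg], by simp [hg]⟩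
  case car_smul c h => exact ⟨_, _, .car_smul c h, by simp [hg], by simp [hg]⟩
  case h_zero i => exact ⟨_, _, .h_zero i, by simp [hg], by simp [hg]⟩
  case h_h i j r s => exact ⟨_, _, .h_h i j r s, by simp [hg, map_lie'], by simp⟩
  case h_car i r h => exact ⟨_, _, .h_car i r h, by simp [hg, map_lie'], by simp⟩
  case car_car h h' => exact ⟨_, _, .car_car h h', by simp [hg, map_lie'], by simp⟩
  case car_x h ε j s => exact ⟨_, _, .car_x h ε j s, by simp [hg, map_lie'], by simp [hg]⟩
  case x_x i j r s =>
    exact ⟨_, _, .x_x i j r s, by simp [hg, map_lie'], by simp [apply_ite f, hg]⟩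
  case h_x ε i j r s =>
    exact ⟨_, _, .h_x ε i j r s, by simp [hg, map_lie'], by simp [hg, hħ]⟩
  case x_x_same ε i j r s =>
    exact ⟨_, _, .x_x_same ε i j r s, by simp [hg, map_lie'], by simp [hg, hħ]⟩
  case serre ε i j hij r s =>
    exact ⟨_, _, .serre ε i j hij r s, by simp [hg, map_iterBracket], by simp⟩

theorem Rel.mapAlgHom {D : Datum I 𝔥} {R : Type} [Semiring R] {E E' : Type*} [Ring E] [Ring E']
    [Algebra ℂ E] [Algebra ℂ E'] (f : E →ₐ[ℂ] E') {ħ : E} {ħ' : E'} {g : Gen I 𝔥 R → E}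
    {g' : Gen I 𝔥 R → E'} (hħ : f ħ = ħ') (hg : ∀ a, f (g a) = g' a) {a b : E}
    (hab : Rel D ħ g a b) : Rel D ħ' g' (f a) (f b) :=
  Rel.map (RingHom.id R) f hħ (fun a => (hg a).trans (by cases a <;> rfl)) hab

namespace PolyAlg

variable (D : Datum I 𝔥) {R : Type} [Semiring R]

theorem realizes :
    Realizes D (algebraMap ℂ[X] (PolyAlg D R) Polynomial.X) (PolyAlg.gen D) := by
  intro a' b' h
  let f : FreeAlgebra ℂ[X] (Gen I 𝔥 R) →ₐ[ℂ[X]] PolyAlg D R := RingQuot.mkAlgHom ℂ[X] _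
  obtain ⟨a, b, hab, rfl, rfl⟩ := Rel.exists_of_map (f.restrictScalars ℂ)
    (g := FreeAlgebra.ι ℂ[X]) (g' := PolyAlg.gen D)
    (f.commutes Polynomial.X) (fun _ => rfl) h
  exact RingQuot.mkAlgHom_rel ℂ[X] hab

variable {D}

/-- The universal property of `PolyAlg D R`. -/
def lift {B : Type*} [Ring B] [Algebra ℂ B] [Algebra ℂ[X] B] [IsScalarTower ℂ ℂ[X] B]
    (g : Gen I 𝔥 R → B) (hg : Realizes D (algebraMap ℂ[X] B Polynomial.X) g) :
    PolyAlg D R →ₐ[ℂ[X]] B :=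
  RingQuot.liftAlgHom ℂ[X] ⟨FreeAlgebra.lift ℂ[X] g, fun _ _ hab =>
    hg _ _ (hab.mapAlgHom ((FreeAlgebra.lift ℂ[X] g).restrictScalars ℂ)
      ((FreeAlgebra.lift ℂ[X] g).commutes Polynomial.X) fun a => FreeAlgebra.lift_ι_apply g a)⟩

theorem lift_gen {B : Type*} [Ring B] [Algebra ℂ B] [Algebra ℂ[X] B] [IsScalarTower ℂ ℂ[X] B]
    (g : Gen I 𝔥 R → B) (hg : Realizes D (algebraMap ℂ[X] B Polynomial.X) g) (a : Gen I 𝔥 R) :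
    lift g hg (gen D a) = g a := by
  simp [lift, gen, RingQuot.liftAlgHom_mkAlgHom_apply]

/-- Generation is needed over `ℂ`, with `ħ` as an extra generator, because the formal shift moves
`ħ` and so is not `ℂ[ħ]`-linear. -/
theorem gen_mem_induction {S : Subalgebra ℂ (PolyAlg D R)}
    (hX : algebraMap ℂ[X] _ Polynomial.X ∈ S) (hgen : ∀ a, gen D a ∈ S) (y : PolyAlg D R) :
    y ∈ S := by
  obtain ⟨z, rfl⟩ := RingQuot.mkAlgHom_surjective ℂ[X] _ y
  induction z using FreeAlgebra.induction with
  | grade0 p =>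
    rw [AlgHom.commutes]
    induction p using Polynomial.induction_on' with
    | add p q hp hq => rw [map_add]; exact add_mem hp hq
    | monomial n c =>
      rw [← Polynomial.C_mul_X_pow_eq_monomial, map_mul, map_pow]
      exact mul_mem (S.algebraMap_mem c) (pow_mem hX n)
  | grade1 a => exact hgen a
  | mul a b ha hb => rw [map_mul]; exact mul_mem ha hb
  | add a b ha hb => rw [map_add]; exact add_mem ha hb

variable (D R) in
theorem adjoin_eq_top :
    Algebra.adjoin ℂ (insert (algebraMap ℂ[X] (PolyAlg D R) Polynomial.X)
      (Set.range (gen D (R := R)))) = ⊤ :=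
  Algebra.eq_top_iff.2 <| gen_mem_induction (Algebra.subset_adjoin (Set.mem_insert _ _))
    fun a => Algebra.subset_adjoin (Set.mem_insert_of_mem _ ⟨a, rfl⟩)

theorem hom_ext {B : Type*} [Semiring B] [Algebra ℂ[X] B] {f f' : PolyAlg D R →ₐ[ℂ[X]] B}
    (hgen : ∀ a, f (gen D a) = f' (gen D a)) : f = f' :=
  RingQuot.ringQuot_ext' _ _ _ (FreeAlgebra.hom_ext (funext hgen))

end PolyAlg

end Presentation

/-! ### Multilinearity of iterated commutators. -/

section Bracket

/-- An iterated commutator is a product of operators `ad (y k)` applied to `z`; in this form it is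
visibly multilinear, so sums can be expanded. -/
theorem iterBracket_eq {E : Type*} [Ring E] {m : ℕ} (y : Fin m → E) (z : E) :
    iterBracket y z = ((MultilinearMap.mkPiAlgebraFin ℤ m (Module.End ℤ E)).compLinearMap
      fun _ => LinearMap.mul ℤ E - (LinearMap.mul ℤ E).flip) y z := by
  rw [MultilinearMap.compLinearMap_apply, MultilinearMap.mkPiAlgebraFin_apply, iterBracket]
  have key : ∀ l : List E, l.foldr (fun a b => ⁅a, b⁆) z =
      (l.map fun a => (LinearMap.mul ℤ E - (LinearMap.mul ℤ E).flip) a).prod z := by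
    intro l
    induction l with
    | nil => rfl
    | cons a l ih => rw [List.foldr_cons, ih, Ring.lie_def]; rfl
  rw [key, List.map_ofFn]
  rfl

theorem iterBracket_sum_smul {E : Type*} [Ring E] {m : ℕ} (s : Finset ℕ) (c : Fin m → ℕ → ℤ)
    (y : ℕ → E) (z : E) :
    iterBracket (fun k => ∑ n ∈ s, c k n • y n) z =
      ∑ f ∈ Fintype.piFinset fun _ : Fin m => s,
        (∏ k, c k (f k)) • iterBracket (fun k => y (f k)) z := by
  simp only [iterBracket_eq]
  rw [MultilinearMap.map_sum_finset, LinearMap.sum_apply]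
  refine Finset.sum_congr rfl fun f _ => ?_
  rw [MultilinearMap.map_smul_univ, LinearMap.smul_apply]

theorem iterBracket_sum_smul_right {E : Type*} [Ring E] {m : ℕ} (s : Finset ℕ) (c : ℕ → ℤ)
    (y : Fin m → E) (z : ℕ → E) :
    iterBracket y (∑ n ∈ s, c n • z n) = ∑ n ∈ s, c n • iterBracket y (z n) := by
  simp only [iterBracket_eq, map_sum, map_zsmul]

/-- A symmetrized iterated commutator of linear combinations vanishes if those of the summands
do. -/
theorem sum_perm_iterBracket_eq_zero {E : Type*} [Ring E] {m : ℕ} (s : Finset ℕ)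
    (c : Fin m → ℕ → ℤ) (c' : ℕ → ℤ) (y z : ℕ → E)
    (h : ∀ (f : Fin m → ℕ) (n : ℕ),
      ∑ π : Equiv.Perm (Fin m), iterBracket (fun k => y (f (π k))) (z n) = 0) :
    ∑ π : Equiv.Perm (Fin m),
      iterBracket (fun k => ∑ n ∈ s, c (π k) n • y n) (∑ n ∈ s, c' n • z n) = 0 := by
  simp only [iterBracket_sum_smul_right]
  rw [Finset.sum_comm]
  refine Finset.sum_eq_zero fun n _ => ?_
  rw [← Finset.smul_sum]
  -- Reindexing `f` by `π` moves the permutation from the coefficients to the modes. The coefficient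
  -- no longer depends on `π`, and the sum over `π` can be taken inside.
  have key : ∀ π : Equiv.Perm (Fin m),
      iterBracket (fun k => ∑ n ∈ s, c (π k) n • y n) (z n) =
      ∑ f ∈ Fintype.piFinset fun _ : Fin m => s,
        (∏ k, c k (f k)) • iterBracket (fun k => y (f (π k))) (z n) := by
    intro π
    rw [iterBracket_sum_smul s (fun k => c (π k))]
    refine Finset.sum_nbij' (fun f => f ∘ π.symm) (fun f => f ∘ π) ?_ ?_ ?_ ?_ ?_
    · intro f hf
      simp only [Fintype.mem_piFinset] at hf ⊢
      exact fun k => hf _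
    · intro f hf
      simp only [Fintype.mem_piFinset] at hf ⊢
      exact fun k => hf _
    · intro f _; ext k; simp
    · intro f _; ext k; simp
    · intro f _
      rw [← Equiv.prod_comp π fun k => c k ((f ∘ π.symm) k)]
      simp
  simp only [key]
  rw [Finset.sum_comm]
  simp only [← Finset.smul_sum, h, smul_zero, Finset.sum_const_zero]

end Bracket

/-! ### Binomial series and the defining relations. -/

section BinomialSeries

open Finset

variable {A : Type*} [Ring A]

/-- The formal series `∑ k, (r choose k) a_k t ^ k`. -/
def binSeries (r : ℤ) (a : ℕ → A) : A⟦X⟧ :=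
  PowerSeries.mk fun k => Ring.choose r k • a k

@[simp]
theorem coeff_binSeries (r : ℤ) (a : ℕ → A) (k : ℕ) :
    PowerSeries.coeff k (binSeries r a) = Ring.choose r k • a k :=
  PowerSeries.coeff_mk _ _

theorem binSeries_zero (a : ℕ → A) : binSeries 0 a = PowerSeries.C (a 0) := by
  ext k
  rw [coeff_binSeries, PowerSeries.coeff_C, Ring.choose_zero_ite]
  split_ifs with h <;> simp [h]

/-- Pascal's rule, that is, `(1 + t u) ^ (r + 1) = (1 + t u) ^ r + t u (1 + t u) ^ r`. -/
theorem binSeries_succ (r : ℤ) (a : ℕ → A) :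
    binSeries (r + 1) a = binSeries r a + PowerSeries.X * binSeries r fun k => a (k + 1) := by
  ext k
  cases k with
  | zero =>
    rw [map_add, PowerSeries.coeff_zero_X_mul, add_zero]
    simp only [coeff_binSeries, Ring.choose_zero_right]
  | succ k =>
    rw [map_add, PowerSeries.coeff_succ_X_mul]
    simp only [coeff_binSeries]
    rw [Ring.choose_succ_succ, add_smul, add_comm]

theorem coeff_mul_binSeries (r s : ℤ) (a b : ℕ → A) (n : ℕ) :
    PowerSeries.coeff n (binSeries r a * binSeries s b) =
      ∑ p ∈ antidiagonal n, (Ring.choose r p.1 * Ring.choose s p.2) • (a p.1 * b p.2) := by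
  simp only [PowerSeries.coeff_mul, coeff_binSeries, smul_mul_smul_comm]

theorem coeff_mul_binSeries_swap (r s : ℤ) (a b : ℕ → A) (n : ℕ) :
    PowerSeries.coeff n (binSeries s b * binSeries r a) =
      ∑ p ∈ antidiagonal n, (Ring.choose r p.1 * Ring.choose s p.2) • (b p.2 * a p.1) := by
  rw [coeff_mul_binSeries, ← Finset.Nat.sum_antidiagonal_swap]
  simp only [Prod.fst_swap, Prod.snd_swap, mul_comm (Ring.choose s _)]

theorem coeff_lie_binSeries (r s : ℤ) (a b : ℕ → A) (n : ℕ) :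
    PowerSeries.coeff n ⁅binSeries r a, binSeries s b⁆ =
      ∑ p ∈ antidiagonal n, (Ring.choose r p.1 * Ring.choose s p.2) • ⁅a p.1, b p.2⁆ := by
  simp only [Ring.lie_def, map_sub, coeff_mul_binSeries_swap r s a b, coeff_mul_binSeries,
    smul_sub, sum_sub_distrib]

theorem lie_binSeries_eq_zero (r s : ℤ) {a b : ℕ → A} (h : ∀ k l, ⁅a k, b l⁆ = 0) :
    ⁅binSeries r a, binSeries s b⁆ = 0 := by
  ext n
  simp [coeff_lie_binSeries, h]

/-- Vandermonde's identity for `r + s`, applied in each degree of `t`. -/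
theorem lie_binSeries_eq (r s : ℤ) {a b c : ℕ → A} (h : ∀ k l, ⁅a k, b l⁆ = c (k + l)) :
    ⁅binSeries r a, binSeries s b⁆ = binSeries (r + s) c := by
  ext n
  rw [coeff_lie_binSeries, coeff_binSeries, Ring.add_choose_eq n (Commute.all r s), sum_smul]
  refine sum_congr rfl fun p hp => ?_
  rw [h, mem_antidiagonal.1 hp]

theorem coeff_lie_C_binSeries (y : A) (s : ℤ) (b : ℕ → A) (n : ℕ) :
    PowerSeries.coeff n ⁅PowerSeries.C y, binSeries s b⁆ = Ring.choose s n • ⁅y, b n⁆ := by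
  simp only [Ring.lie_def, smul_sub, map_sub, PowerSeries.coeff_C_mul, PowerSeries.coeff_mul_C,
    coeff_binSeries, mul_smul_comm, smul_mul_assoc]

theorem coeff_lie_binSeries_C (y : A) (s : ℤ) (b : ℕ → A) (n : ℕ) :
    PowerSeries.coeff n ⁅binSeries s b, PowerSeries.C y⁆ = Ring.choose s n • ⁅b n, y⁆ := by
  simp only [Ring.lie_def, smul_sub, map_sub, PowerSeries.coeff_C_mul, PowerSeries.coeff_mul_C,
    coeff_binSeries, mul_smul_comm, smul_mul_assoc]

theorem lie_X_mul (x y : A⟦X⟧) : ⁅PowerSeries.X * x, y⁆ = PowerSeries.X * ⁅x, y⁆ := by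
  rw [Ring.lie_def, Ring.lie_def, mul_sub, mul_assoc, ← mul_assoc y,
    (PowerSeries.commute_X y).eq, mul_assoc]

theorem lie_X_mul_right (x y : A⟦X⟧) : ⁅x, PowerSeries.X * y⁆ = PowerSeries.X * ⁅x, y⁆ := by
  rw [Ring.lie_def, Ring.lie_def, mul_sub, mul_assoc, ← mul_assoc x,
    (PowerSeries.commute_X x).eq, mul_assoc]

theorem add_lie_ring {E : Type*} [Ring E] (x x' y : E) : ⁅x + x', y⁆ = ⁅x, y⁆ + ⁅x', y⁆ := by
  simp only [Ring.lie_def, add_mul, mul_add]; abel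

theorem lie_add_ring {E : Type*} [Ring E] (x y y' : E) : ⁅x, y + y'⁆ = ⁅x, y⁆ + ⁅x, y'⁆ := by
  simp only [Ring.lie_def, add_mul, mul_add]; abel

/-- By Pascal's rule the terms without a shifted mode cancel, and the rest is `t` times the given
relation summed against binomial coefficients. This factor `t` is what forces `ħ ↦ t ħ`. -/
theorem lie_succ_binSeries [Algebra ℂ A] (r s : ℤ) {a b : ℕ → A} {c : ℂ} {ħ : A}
    (h : ∀ k l, ⁅a (k + 1), b l⁆ - ⁅a k, b (l + 1)⁆ = c • (ħ * (a k * b l + b l * a k))) :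
    ⁅binSeries (r + 1) a, binSeries s b⁆ - ⁅binSeries r a, binSeries (s + 1) b⁆ =
      c • ((PowerSeries.X * PowerSeries.C ħ) *
        (binSeries r a * binSeries s b + binSeries s b * binSeries r a)) := by
  rw [binSeries_succ, binSeries_succ, add_lie_ring, lie_add_ring, lie_X_mul, lie_X_mul_right,
    add_sub_add_left_eq_sub, ← mul_sub, mul_assoc, ← mul_smul_comm]
  congr 1
  ext n
  rw [map_sub, coeff_lie_binSeries, coeff_lie_binSeries, PowerSeries.coeff_smul,
    PowerSeries.coeff_C_mul, map_add, coeff_mul_binSeries_swap r s a b, coeff_mul_binSeries,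
    ← sum_sub_distrib, ← sum_add_distrib, mul_sum, smul_sum]
  refine sum_congr rfl fun p _ => ?_
  rw [← smul_sub, h, ← smul_add, mul_smul_comm, smul_comm c]

theorem lie_monomial (i j : ℕ) (a b : A) :
    ⁅PowerSeries.monomial i a, PowerSeries.monomial j b⁆ = PowerSeries.monomial (i + j) ⁅a, b⁆ := by
  rw [Ring.lie_def, Ring.lie_def, PowerSeries.monomial_mul_monomial,
    PowerSeries.monomial_mul_monomial, map_sub, add_comm j]

theorem iterBracket_monomial {m : ℕ} (i : Fin m → ℕ) (a : Fin m → A) (j : ℕ) (b : A) :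
    iterBracket (fun k => PowerSeries.monomial (i k) (a k)) (PowerSeries.monomial j b) =
      PowerSeries.monomial (∑ k, i k + j) (iterBracket a b) := by
  induction m with
  | zero => simp [iterBracket]
  | succ m ih =>
    have := ih (fun k => i k.succ) (fun k => a k.succ)
    simp only [iterBracket, List.ofFn_succ, List.foldr_cons] at this ⊢
    rw [this, lie_monomial, Fin.sum_univ_succ, add_assoc]

theorem coeff_lie_congr {n : ℕ} {x x' y y' : A⟦X⟧}
    (hx : ∀ i ≤ n, PowerSeries.coeff i x = PowerSeries.coeff i x')
    (hy : ∀ i ≤ n, PowerSeries.coeff i y = PowerSeries.coeff i y') :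
    ∀ i ≤ n, PowerSeries.coeff i ⁅x, y⁆ = PowerSeries.coeff i ⁅x', y'⁆ := by
  intro i hi
  rw [Ring.lie_def, Ring.lie_def, map_sub, map_sub]
  simp only [PowerSeries.coeff_mul]
  congr 1 <;>
  · refine sum_congr rfl fun p hp => ?_
    have := mem_antidiagonal.1 hp
    rw [hx _ (by omega), hy _ (by omega)]

theorem coeff_iterBracket_congr {n m : ℕ} {y y' : Fin m → A⟦X⟧} {z z' : A⟦X⟧}
    (hy : ∀ k, ∀ i ≤ n, PowerSeries.coeff i (y k) = PowerSeries.coeff i (y' k))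
    (hz : ∀ i ≤ n, PowerSeries.coeff i z = PowerSeries.coeff i z') :
    ∀ i ≤ n, PowerSeries.coeff i (iterBracket y z) = PowerSeries.coeff i (iterBracket y' z') := by
  induction m with
  | zero => simpa [iterBracket] using hz
  | succ m ih =>
    have := ih (y := fun k => y k.succ) (y' := fun k => y' k.succ) fun k => hy _
    simp only [iterBracket, List.ofFn_succ, List.foldr_cons] at this ⊢
    exact coeff_lie_congr (hy 0) this

theorem coeff_binSeries_trunc (r : ℤ) (a : ℕ → A) (n : ℕ) :
    ∀ i ≤ n, PowerSeries.coeff i (binSeries r a) = PowerSeries.coeff i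
      (∑ k ∈ range (n + 1), Ring.choose r k • PowerSeries.monomial k (a k)) := by
  intro i hi
  simp only [map_sum, map_zsmul, PowerSeries.coeff_monomial, coeff_binSeries, smul_ite, smul_zero]
  rw [sum_ite_eq, if_pos (mem_range.2 (by omega))]

/-- The coefficient of `t ^ n` sees only the terms of degree at most `n`, so the series may be
replaced by finite sums of monomials and expanded multilinearly. For monomials the total degree is
the same for all permutations, which leaves the hypothesis. -/
theorem serre_binSeries {m : ℕ} (r : Fin m → ℤ) (s : ℤ) {a b : ℕ → A}
    (h : ∀ (f : Fin m → ℕ) (l : ℕ),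
      ∑ π : Equiv.Perm (Fin m), iterBracket (fun k => a (f (π k))) (b l) = 0) :
    ∑ π : Equiv.Perm (Fin m),
      iterBracket (fun k => binSeries (r (π k)) a) (binSeries s b) = 0 := by
  ext n
  have := sum_perm_iterBracket_eq_zero (range (n + 1)) (fun k => Ring.choose (r k))
    (Ring.choose s) (fun k => PowerSeries.monomial k (a k))
    (fun k => PowerSeries.monomial k (b k)) (m := m) fun f l => by
      simp only [iterBracket_monomial]
      have hs : ∀ π : Equiv.Perm (Fin m), ∑ k, f (π k) = ∑ k, f k := fun π => Equiv.sum_comp π f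
      simp only [hs, ← map_sum, h, map_zero]
  rw [← this, map_sum, map_sum]
  exact sum_congr rfl fun π _ => coeff_iterBracket_congr
    (fun k => coeff_binSeries_trunc _ _ _) (coeff_binSeries_trunc _ _ _) n le_rfl

end BinomialSeries

/-! ### The formal shift respects the relations of the double. -/

section Expansion

variable {I : Type u} {𝔥 : Type v}

/-- The images of the generators of the double under the formal shift `u ↦ 1 + t u`, where `g` are
the images of the generators of the Yangian. -/
def expand {A : Type*} [Ring A] (g : Gen I 𝔥 ℕ → A) : Gen I 𝔥 ℤ → A⟦X⟧
  | .car y => PowerSeries.C (g (.car y))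
  | .x ε i r => binSeries r fun k => g (.x ε i k)
  | .h i r => binSeries r fun k => g (.h i k)

variable [Fintype I] [DecidableEq I] [AddCommGroup 𝔥] [Module ℂ 𝔥]

theorem Realizes.expand {D : Datum I 𝔥} {A : Type*} [Ring A] [Algebra ℂ A] {ħ : A}
    {g : Gen I 𝔥 ℕ → A} (hg : Realizes D ħ g) :
    Realizes D (PowerSeries.X * PowerSeries.C ħ) (expand g) := by
  intro a b hab
  cases hab <;> simp only [KacMoodyYangian.expand]
  case car_add h h' => rw [hg _ _ (.car_add h h'), map_add]
  case car_smul c h =>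
    rw [hg _ _ (.car_smul c h)]
    ext n
    rw [PowerSeries.coeff_smul, PowerSeries.coeff_C, PowerSeries.coeff_C]
    split_ifs <;> simp
  case h_zero i => rw [binSeries_zero, hg _ _ (.h_zero i)]
  case h_h i j r s => exact lie_binSeries_eq_zero r s fun k l => hg _ _ (.h_h i j k l)
  case h_car i r h =>
    ext n
    rw [coeff_lie_binSeries_C, hg _ _ (.h_car i n h), smul_zero, map_zero]
  case car_car h h' => rw [← map_zero PowerSeries.C, ← hg _ _ (.car_car h h')]; simp [Ring.lie_def]
  case car_x h ε j s =>
    ext n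
    rw [coeff_lie_C_binSeries, hg _ _ (.car_x h ε j n), PowerSeries.coeff_smul, coeff_binSeries,
      smul_comm]
  case x_x i j r s =>
    split_ifs with hij
    · exact lie_binSeries_eq r s fun k l => by rw [hg _ _ (.x_x i j k l), if_pos hij]
    · exact lie_binSeries_eq_zero r s fun k l => by rw [hg _ _ (.x_x i j k l), if_neg hij]
  case h_x ε i j r s => exact lie_succ_binSeries r s fun k l => hg _ _ (.h_x ε i j k l)
  case x_x_same ε i j r s =>
    exact lie_succ_binSeries r s fun k l => hg _ _ (.x_x_same ε i j k l)
  case serre ε i j hij r s =>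
    exact serre_binSeries r s fun f l => hg _ _ (.serre ε i j hij f l)

end Expansion

/-! ### Evaluation of power series at `t ħ`. -/

section ScaledEval

open Finset

/-- Both sides sum over all quadruples with total `n`, grouped in two ways; this is the bookkeeping
behind `scaledSum_mul`. -/
theorem sum_antidiagonal_four_comm {M : Type*} [AddCommMonoid M] (n : ℕ) (f : ℕ → ℕ → ℕ → ℕ → M) :
    ∑ p ∈ antidiagonal n, ∑ q ∈ antidiagonal p.1, ∑ r ∈ antidiagonal p.2, f q.1 q.2 r.1 r.2 =
      ∑ p ∈ antidiagonal n, ∑ q ∈ antidiagonal p.1, ∑ r ∈ antidiagonal p.2,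
        f q.1 r.1 q.2 r.2 := by
  simp only [← sum_product']
  simp only [sum_sigma']
  refine sum_nbij' (fun x => ⟨(x.2.1.1 + x.2.2.1, x.2.1.2 + x.2.2.2), (x.2.1.1, x.2.2.1),
    (x.2.1.2, x.2.2.2)⟩) (fun x => ⟨(x.2.1.1 + x.2.2.1, x.2.1.2 + x.2.2.2), (x.2.1.1, x.2.2.1),
    (x.2.1.2, x.2.2.2)⟩) ?_ ?_ ?_ ?_ ?_
  · rintro ⟨⟨p, q⟩, ⟨a, b⟩, c, d⟩
    simp only [mem_sigma, mem_product, HasAntidiagonal.mem_antidiagonal, and_true]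
    intro h
    omega
  · rintro ⟨⟨p, q⟩, ⟨a, b⟩, c, d⟩
    simp only [mem_sigma, mem_product, HasAntidiagonal.mem_antidiagonal, and_true]
    intro h
    omega
  · rintro ⟨⟨p, q⟩, ⟨a, b⟩, c, d⟩
    simp only [mem_sigma, mem_product, HasAntidiagonal.mem_antidiagonal]
    rintro ⟨-, rfl, rfl⟩
    rfl
  · rintro ⟨⟨p, q⟩, ⟨a, b⟩, c, d⟩
    simp only [mem_sigma, mem_product, HasAntidiagonal.mem_antidiagonal]
    rintro ⟨-, rfl, rfl⟩
    rfl
  · rintro ⟨⟨p, q⟩, ⟨a, b⟩, c, d⟩ -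
    rfl

variable {S A : Type*} [Ring S] [Algebra ℂ S] [Ring A] [Algebra ℂ A]

/-- The power series `∑ n, φ(F_n) (t ħ) ^ n` over `A`, for a power series `F` over `S`. -/
def scaledSum (ħ : A) (φ : S →ₐ[ℂ] A⟦X⟧) (F : S⟦X⟧) : A⟦X⟧ :=
  PowerSeries.mk fun n => ∑ p ∈ antidiagonal n,
    ħ ^ p.1 * PowerSeries.coeff p.2 (φ (PowerSeries.coeff p.1 F))

theorem coeff_scaledSum (ħ : A) (φ : S →ₐ[ℂ] A⟦X⟧) (F : S⟦X⟧) (n : ℕ) :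
    PowerSeries.coeff n (scaledSum ħ φ F) = ∑ p ∈ antidiagonal n,
      ħ ^ p.1 * PowerSeries.coeff p.2 (φ (PowerSeries.coeff p.1 F)) :=
  PowerSeries.coeff_mk _ _

theorem scaledSum_C (ħ : A) (φ : S →ₐ[ℂ] A⟦X⟧) (a : S) :
    scaledSum ħ φ (PowerSeries.C a) = φ a := by
  ext n
  rw [coeff_scaledSum, sum_eq_single (0, n)]
  · simp
  · rintro ⟨i, j⟩ hij hne
    rw [HasAntidiagonal.mem_antidiagonal] at hij
    have : i ≠ 0 := by
      rintro rfl
      exact hne (by simpa using hij)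
    simp [PowerSeries.coeff_C, this]
  · simp

theorem scaledSum_X (ħ : A) (φ : S →ₐ[ℂ] A⟦X⟧) :
    scaledSum ħ φ PowerSeries.X = PowerSeries.X * PowerSeries.C ħ := by
  ext n
  rw [coeff_scaledSum]
  cases n with
  | zero => simp
  | succ n =>
    rw [PowerSeries.coeff_succ_X_mul, sum_eq_single (1, n)]
    · simp [PowerSeries.coeff_C, PowerSeries.coeff_one]
    · rintro ⟨i, j⟩ hij hne
      rw [HasAntidiagonal.mem_antidiagonal] at hij
      have : i ≠ 1 := by
        rintro rfl
        exact hne (by simp only at hij; congr 1; omega)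
      simp [PowerSeries.coeff_X, this]
    · intro h
      exact absurd (HasAntidiagonal.mem_antidiagonal.2 (add_comm 1 n)) h

theorem scaledSum_mul {ħ : A} (hħ : ∀ a, Commute ħ a) (φ : S →ₐ[ℂ] A⟦X⟧) (F G : S⟦X⟧) :
    scaledSum ħ φ (F * G) = scaledSum ħ φ F * scaledSum ħ φ G := by
  ext n
  simp only [PowerSeries.coeff_mul, coeff_scaledSum, map_sum, map_mul, sum_mul_sum]
  have := sum_antidiagonal_four_comm n fun a c b d =>
    ħ ^ (a + c) * (PowerSeries.coeff b (φ (PowerSeries.coeff a F)) *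
      PowerSeries.coeff d (φ (PowerSeries.coeff c G)))
  simp only [mul_sum]
  refine Eq.trans (sum_congr rfl fun p _ => ?_) (this.trans
    (sum_congr rfl fun p _ => sum_congr rfl fun q _ => sum_congr rfl fun r _ => ?_))
  · refine sum_congr rfl fun q hq => sum_congr rfl fun r hr => ?_
    rw [HasAntidiagonal.mem_antidiagonal.1 hq]
  -- Centrality of `ħ` lets its power pass the coefficient coming from `F`.
  · rw [pow_add, mul_assoc, mul_assoc, ← mul_assoc (ħ ^ r.1), ← mul_assoc _ (ħ ^ r.1),
      ((hħ _).pow_left r.1).eq]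

/-- The extension of `φ : S → A⟦t⟧` to power series over `S`, which sends the variable to `t ħ`,
for a central element `ħ` of `A`. -/
def scaledEval (ħ : A) (hħ : ∀ a, Commute ħ a) (φ : S →ₐ[ℂ] A⟦X⟧) : S⟦X⟧ →ₐ[ℂ] A⟦X⟧ where
  toFun := scaledSum ħ φ
  map_one' := by rw [← map_one PowerSeries.C, scaledSum_C, map_one]
  map_mul' := scaledSum_mul hħ φ
  map_zero' := by rw [← map_zero PowerSeries.C, scaledSum_C, map_zero]
  map_add' F G := by
    ext n
    simp only [map_add, mul_add, sum_add_distrib, coeff_scaledSum]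
  commutes' c := by
    rw [PowerSeries.algebraMap_apply, scaledSum_C, AlgHom.commutes]

end ScaledEval

/-! ### The formal shift on the completed double. -/

section FormalShift

variable {I : Type u} {𝔥 : Type v} {A : Type*} [Ring A] [Algebra ℂ A]

/-- The map from the topologically free algebra which induces the formal shift. -/
def topFreeEval (ħ : A) (hħ : ∀ a, Commute ħ a) (g : Gen I 𝔥 ℕ → A) :
    TopFree (Gen I 𝔥 ℤ) →ₐ[ℂ] A⟦X⟧ :=
  scaledEval ħ hħ (FreeAlgebra.lift ℂ (expand g))

theorem topFreeEval_hbar {ħ : A} (hħ : ∀ a, Commute ħ a) (g : Gen I 𝔥 ℕ → A) :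
    topFreeEval ħ hħ g TopFree.hbar = PowerSeries.X * PowerSeries.C ħ :=
  scaledSum_X _ _

theorem topFreeEval_of {ħ : A} (hħ : ∀ a, Commute ħ a) (g : Gen I 𝔥 ℕ → A) (a : Gen I 𝔥 ℤ) :
    topFreeEval ħ hħ g (TopFree.of a) = expand g a :=
  (scaledSum_C _ _ _).trans (FreeAlgebra.lift_ι_apply _ _)

variable [Fintype I] [DecidableEq I] [AddCommGroup 𝔥] [Module ℂ 𝔥] {D : Datum I 𝔥}

/-- The ideal itself dies by `Realizes.expand`. An element of the closure differs from the ideal by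
multiples of arbitrarily high powers of `ħ`, whose images are divisible by equally high powers of
`t`. -/
theorem topFreeEval_closure {ħ : A} (hħ : ∀ a, Commute ħ a) {g : Gen I 𝔥 ℕ → A}
    (hg : Realizes D ħ g) {F : TopFree (Gen I 𝔥 ℤ)} (hF : F ∈ TopFree.closure (doubleIdeal D)) :
    topFreeEval ħ hħ g F = 0 := by
  have hJ : doubleIdeal D ≤ TwoSidedIdeal.ker (topFreeEval ħ hħ g) := by
    refine TwoSidedIdeal.span_le.2 ?_
    rintro _ ⟨a, b, hab, rfl⟩
    rw [SetLike.mem_coe, TwoSidedIdeal.mem_ker, map_sub, sub_eq_zero]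
    exact hg.expand _ _ (hab.mapAlgHom _ (topFreeEval_hbar hħ g) (topFreeEval_of hħ g))
  rw [TopFree.closure, TwoSidedIdeal.mem_mk'] at hF
  ext n
  -- Precision `n + 1` makes the remainder divisible by `t ^ (n + 1)`, so its coefficient of `t ^ n`
  -- vanishes.
  obtain ⟨G, hG, K, rfl⟩ := hF (n + 1)
  rw [map_add, (TwoSidedIdeal.mem_ker _).1 (hJ hG), zero_add, map_mul, map_pow, topFreeEval_hbar,
    ((PowerSeries.commute_X _).symm).mul_pow, mul_assoc, PowerSeries.coeff_X_pow_mul', map_zero,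
    if_neg (by omega)]

/-- The formal shift `DY_ħ𝔤 → A⟦t⟧` attached to a homomorphism from the Yangian to `A`. -/
def Double.expand {ħ : A} (hħ : ∀ a, Commute ħ a) {g : Gen I 𝔥 ℕ → A}
    (hg : Realizes D ħ g) : Double D →ₐ[ℂ] A⟦X⟧ :=
  RingCon.liftₐ _ (topFreeEval ħ hħ g) fun {a b} hab => by
    change topFreeEval ħ hħ g a = topFreeEval ħ hħ g b
    rw [← sub_eq_zero, ← map_sub]
    exact topFreeEval_closure hħ hg ((TwoSidedIdeal.rel_iff _ _ _).1 hab)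

theorem Double.expand_gen {ħ : A} (hħ : ∀ a, Commute ħ a) {g : Gen I 𝔥 ℕ → A}
    (hg : Realizes D ħ g) (a : Gen I 𝔥 ℤ) :
    Double.expand hħ hg (Double.gen D a) = KacMoodyYangian.expand g a :=
  topFreeEval_of hħ g a

theorem Double.expand_hbar {ħ : A} (hħ : ∀ a, Commute ħ a) {g : Gen I 𝔥 ℕ → A}
    (hg : Realizes D ħ g) :
    Double.expand hħ hg (algebraMap ℂ[X] (Double D) Polynomial.X) =
      PowerSeries.X * PowerSeries.C ħ :=
  (congrArg (topFreeEval ħ hħ g) TopFree.algebraMap_X).trans (topFreeEval_hbar hħ g)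

end FormalShift

/-! ### Specialization at `t = -1` and injectivity. -/

section Involution

variable {A : Type*} [Ring A]

/-- The polynomial `∑ k, (r choose k) a_k t ^ k`. -/
def binPoly : ℕ → (ℕ → A) → A[X]
  | 0, a => Polynomial.C (a 0)
  | r + 1, a => binPoly r a + Polynomial.X * binPoly r fun k => a (k + 1)

theorem coe_binPoly (r : ℕ) (a : ℕ → A) : (binPoly r a : A⟦X⟧) = binSeries r a := by
  induction r generalizing a with
  | zero => rw [binPoly, Polynomial.coe_C, Nat.cast_zero, binSeries_zero]
  | succ r ih =>
    rw [binPoly, Polynomial.coe_add, Polynomial.coe_mul, Polynomial.coe_X, ih, ih, Nat.cast_succ,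
      binSeries_succ]

/-- Evaluation of polynomials over a ring at `-1`. -/
def evalNegOne (A : Type*) [Ring A] : A[X] →+* A :=
  Polynomial.eval₂RingHom' (RingHom.id A) (-1) fun a => (Commute.one_right a).neg_right

theorem evalNegOne_C (a : A) : evalNegOne A (Polynomial.C a) = a :=
  Polynomial.eval₂_C _ _

theorem evalNegOne_X : evalNegOne A Polynomial.X = -1 :=
  Polynomial.eval₂_X _ _

/-- The alternating binomial transform `∑ k, (-1) ^ k (r choose k) a_k`. -/
def altTransform : ℕ → (ℕ → A) → A
  | 0, a => a 0
  | r + 1, a => altTransform r a - altTransform r fun k => a (k + 1)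

theorem evalNegOne_binPoly (r : ℕ) (a : ℕ → A) : evalNegOne A (binPoly r a) = altTransform r a := by
  induction r generalizing a with
  | zero => exact evalNegOne_C _
  | succ r ih =>
    rw [binPoly, map_add, map_mul, evalNegOne_X, ih, ih, altTransform, neg_one_mul, sub_eq_add_neg]

theorem altTransform_sub (r : ℕ) (a b : ℕ → A) :
    (altTransform r fun k => a k - b k) = altTransform r a - altTransform r b := by
  induction r generalizing a b with
  | zero => rfl
  | succ r ih => rw [altTransform, altTransform, altTransform, ih, ih]; abel

theorem map_altTransform (f : A →+* A) (r : ℕ) (a : ℕ → A) :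
    f (altTransform r a) = altTransform r fun k => f (a k) := by
  induction r generalizing a with
  | zero => rfl
  | succ r ih => rw [altTransform, altTransform, map_sub, ih, ih]

/-- The transform is the substitution `u ↦ 1 - u` on modes, which is its own inverse. The inductive
step reads `a r - (a r - a (r + 1)) = a (r + 1)`. -/
theorem altTransform_altTransform (r : ℕ) (a : ℕ → A) :
    (altTransform r fun k => altTransform k a) = a r := by
  induction r generalizing a with
  | zero => rfl
  | succ r ih =>
    rw [altTransform, ih]
    simp only [altTransform]
    rw [altTransform_sub, ih, ih]
    abel

variable {I : Type u} {𝔥 : Type v}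

/-- The polynomials to which generators of the Yangian are mapped by the formal shift. -/
def genPoly (g : Gen I 𝔥 ℕ → A) : Gen I 𝔥 ℕ → A[X]
  | .car y => Polynomial.C (g (.car y))
  | .x ε i r => binPoly r fun k => g (.x ε i k)
  | .h i r => binPoly r fun k => g (.h i k)

theorem coe_genPoly (g : Gen I 𝔥 ℕ → A) (a : Gen I 𝔥 ℕ) :
    (genPoly g a : A⟦X⟧) = expand g (a.mapMode (Nat.castRingHom ℤ)) := by
  cases a with
  | car y => exact Polynomial.coe_C _
  | x ε i r => exact coe_binPoly _ _
  | h i r => exact coe_binPoly _ _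

/-- An algebra endomorphism over power series which extends the formal shift `u ↦ 1 + t u`,
`ħ ↦ t ħ` is injective: it takes values in polynomials, and its evaluation at `t = -1` is an
involution. -/
theorem injective_of_expand [Algebra ℂ A] {g : Gen I 𝔥 ℕ → A} {ħ : A}
    (hgen : Algebra.adjoin ℂ (insert ħ (Set.range g)) = ⊤) (θ : A →ₐ[ℂ] A⟦X⟧)
    (hħ : θ ħ = PowerSeries.X * PowerSeries.C ħ)
    (hg : ∀ a, θ (g a) = expand g (a.mapMode (Nat.castRingHom ℤ))) :
    Function.Injective θ := by
  have hθC : ∀ c : ℂ, ((Polynomial.C (algebraMap ℂ A c) : A[X]) : A⟦X⟧) =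
      θ (algebraMap ℂ A c) := fun c => by
    rw [Polynomial.coe_C, AlgHom.commutes, PowerSeries.algebraMap_apply]
  have hθħ : ((Polynomial.X * Polynomial.C ħ : A[X]) : A⟦X⟧) = θ ħ := by
    rw [hħ, Polynomial.coe_mul, Polynomial.coe_X, Polynomial.coe_C]
  have hθg : ∀ a, (genPoly g a : A⟦X⟧) = θ (g a) := fun a => by rw [coe_genPoly, hg]
  -- Evaluation at `t = -1` needs polynomials; it is enough that `θ` has polynomial values on
  -- generators.
  have hmem : ∀ y : A, ∃ p : A[X], (p : A⟦X⟧) = θ y := fun y => by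
    have hy : y ∈ Algebra.adjoin ℂ (insert ħ (Set.range g)) := hgen ▸ Algebra.mem_top
    induction hy using Algebra.adjoin_induction with
    | mem y hy =>
      obtain rfl | ⟨a, rfl⟩ := hy
      · exact ⟨_, hθħ⟩
      · exact ⟨_, hθg a⟩
    | algebraMap c => exact ⟨_, hθC c⟩
    | add x y _ _ hx hy =>
      obtain ⟨⟨p, hp⟩, q, hq⟩ := And.intro hx hy
      exact ⟨p + q, by rw [Polynomial.coe_add, hp, hq, map_add]⟩
    | mul x y _ _ hx hy =>
      obtain ⟨⟨p, hp⟩, q, hq⟩ := And.intro hx hy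
      exact ⟨p * q, by rw [Polynomial.coe_mul, hp, hq, map_mul]⟩
  choose P hP using hmem
  have hPeq : ∀ {y : A} {p : A[X]}, (p : A⟦X⟧) = θ y → P y = p := fun h =>
    Polynomial.coe_injective _ ((hP _).trans h.symm)
  -- Polynomials embed in power series, so the chosen `P y` is unique and depends on `y` as a ring
  -- homomorphism.
  let η : A →+* A := (evalNegOne A).comp
    { toFun := P
      map_one' := hPeq (by rw [Polynomial.coe_one, map_one])
      map_mul' := fun x y => hPeq (by rw [Polynomial.coe_mul, hP, hP, map_mul])
      map_zero' := hPeq (by rw [Polynomial.coe_zero, map_zero])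
      map_add' := fun x y => hPeq (by rw [Polynomial.coe_add, hP, hP, map_add]) }
  have hη : ∀ {y : A} {p : A[X]}, (p : A⟦X⟧) = θ y → η y = evalNegOne A p := fun h =>
    congrArg (evalNegOne A) (hPeq h)
  have hηη : ∀ y, η (η y) = y := fun y => by
    have hy : y ∈ Algebra.adjoin ℂ (insert ħ (Set.range g)) := hgen ▸ Algebra.mem_top
    induction hy using Algebra.adjoin_induction with
    | mem y hy =>
      obtain rfl | ⟨a, rfl⟩ := hy
      · have : η y = -y := by rw [hη hθħ, map_mul, evalNegOne_C, evalNegOne_X, neg_one_mul]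
        rw [this, map_neg, this, neg_neg]
      · cases a with
        | car y =>
          have : η (g (.car y)) = g (.car y) := (hη (hθg _)).trans (evalNegOne_C _)
          rw [this, this]
        | x ε i r =>
          have (k : ℕ) : η (g (.x ε i k)) = altTransform k fun k => g (.x ε i k) :=
            (hη (hθg _)).trans (evalNegOne_binPoly _ _)
          rw [this, map_altTransform]
          simp only [this]
          exact altTransform_altTransform r _
        | h i r =>
          have (k : ℕ) : η (g (.h i k)) = altTransform k fun k => g (.h i k) :=
            (hη (hθg _)).trans (evalNegOne_binPoly _ _)
          rw [this, map_altTransform]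
          simp only [this]
          exact altTransform_altTransform r _
    | algebraMap c =>
      have : η (algebraMap ℂ A c) = algebraMap ℂ A c := (hη (hθC c)).trans (evalNegOne_C _)
      rw [this, this]
    | add x y _ _ hx hy => rw [map_add, map_add, hx, hy]
    | mul x y _ _ hx hy => rw [map_mul, map_mul, hx, hy]
  refine (injective_iff_map_eq_zero θ).2 fun y hy => ?_
  -- If `θ y = 0`, its polynomial is `0`, so `η y = 0` and `y = η (η y) = 0`.
  rw [← hηη y, hη (p := 0) (Polynomial.coe_zero.trans hy.symm), map_zero, map_zero]

end Involution

/-! ### Embedding of the Yangian into its double. -/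

section Embedding

variable {I : Type u} {𝔥 : Type v} [Fintype I] [DecidableEq I] [AddCommGroup 𝔥] [Module ℂ 𝔥]
  (D : Datum I 𝔥)

instance : IsScalarTower ℂ ℂ[X] (Double D) :=
  IsScalarTower.of_algebraMap_eq fun c => congrArg (RingCon.mkₐ ℂ[X] _)
    (IsScalarTower.algebraMap_apply ℂ ℂ[X] (TopFree (Gen I 𝔥 ℤ)) c)

theorem toDouble_gen (a : Gen I 𝔥 ℕ) :
    toDouble D (PolyAlg.gen D a) = Double.gen D (a.mapMode (Nat.castRingHom ℤ)) := by
  rw [toDouble, AlgHom.comp_apply, toDoubleForm_gen, formToDouble_gen]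

theorem toDouble_injective : Function.Injective (toDouble D) := by
  have hc : ∀ y : Yangian D, Commute (algebraMap ℂ[X] (Yangian D) Polynomial.X) y :=
    Algebra.commute_algebraMap_left _
  have hg := PolyAlg.realizes D (R := ℕ)
  let θ : Yangian D →ₐ[ℂ] (Yangian D)⟦X⟧ :=
    (Double.expand hc hg).comp ((toDouble D).restrictScalars ℂ)
  have hθ : Function.Injective θ := by
    refine injective_of_expand (A := Yangian D) (PolyAlg.adjoin_eq_top D ℕ) θ ?_ fun a => ?_
    · exact (congrArg _ ((toDouble D).commutes _)).trans (Double.expand_hbar hc hg)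
    · exact (congrArg _ (toDouble_gen D a)).trans (Double.expand_gen hc hg _)
  exact Function.Injective.of_comp (f := Double.expand hc hg) hθ

theorem toDoubleForm_injective : Function.Injective (toDoubleForm D) :=
  Function.Injective.of_comp (f := formToDouble D) (toDouble_injective D)

end Embedding

/-! ### Translations of the double by coweights. -/

section LatticeShift

variable {I : Type u} {𝔥 : Type v} [Fintype I] [DecidableEq I] [AddCommGroup 𝔥] [Module ℂ 𝔥]
  (D : Datum I 𝔥)

/-- Generators of the double shifted by a coweight: `x_{jr}^± ↦ x_{j, r ± w j}^±`. -/
def shiftGen (w : I → ℤ) : Gen I 𝔥 ℤ → Gen I 𝔥 ℤ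
  | .car y => .car y
  | .x ε j r => .x ε j (r + ε * w j)
  | .h j r => .h j r

/-- The shifts of `x^+` and `x^-` are opposite, so they cancel in the mode `r + s` of `[x^+, x^-]`.
Every other relation for the `x`'s involves one sign only and holds for all integer modes, so a
translation yields another instance. -/
theorem realizes_shiftGen (w : I → ℤ) :
    Realizes D (algebraMap ℂ[X] (DoubleForm D) Polynomial.X)
      fun a => PolyAlg.gen D (shiftGen w a) := by
  have hg := PolyAlg.realizes D (R := ℤ)
  intro a b hab
  cases hab <;> simp only [shiftGen, add_right_comm _ (1 : ℤ)]
  case car_add h h' => exact hg _ _ (.car_add h h')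
  case car_smul c h => exact hg _ _ (.car_smul c h)
  case h_zero i => exact hg _ _ (.h_zero i)
  case h_h i j r s => exact hg _ _ (.h_h i j r s)
  case h_car i r h => exact hg _ _ (.h_car i r h)
  case car_car h h' => exact hg _ _ (.car_car h h')
  case car_x h ε j s => exact hg _ _ (.car_x h ε j _)
  case x_x i j r s =>
    rw [hg _ _ (.x_x i j _ _)]
    split_ifs with hij
    · subst hij
      congr 2
      push_cast
      ring
    · rfl
  case h_x ε i j r s => exact hg _ _ (.h_x ε i j r _)
  case x_x_same ε i j r s => exact hg _ _ (.x_x_same ε i j _ _)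
  case serre ε i j hij r s => exact hg _ _ (.serre ε i j hij (fun k => r k + ε * w i) _)

/-- The endomorphism of the `ℂ[ħ]`-form of the double given by translation by a coweight. -/
def latticeShift (w : I → ℤ) : DoubleForm D →ₐ[ℂ[X]] DoubleForm D :=
  PolyAlg.lift _ (realizes_shiftGen D w)

theorem latticeShift_gen (w : I → ℤ) (a : Gen I 𝔥 ℤ) :
    latticeShift D w (PolyAlg.gen D a) = PolyAlg.gen D (shiftGen w a) :=
  PolyAlg.lift_gen _ _ a

theorem latticeShift_injective (w : I → ℤ) : Function.Injective (latticeShift D w) := by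
  refine Function.LeftInverse.injective (g := latticeShift D (-w)) fun y => ?_
  have : (latticeShift D (-w)).comp (latticeShift D w) = AlgHom.id ℂ[X] _ :=
    PolyAlg.hom_ext fun a => by
      rw [AlgHom.comp_apply, latticeShift_gen, latticeShift_gen]
      cases a <;> simp [shiftGen]
  exact DFunLike.congr_fun this y

end LatticeShift

/-! ### The shift endomorphisms of the Borel subalgebras. -/

section BorelShift

variable {I : Type u} {𝔥 : Type v} [Fintype I] [DecidableEq I] [AddCommGroup 𝔥] [Module ℂ 𝔥]
  (D : Datum I 𝔥) (ε : ℤˣ) (i : I)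

/-- Translation of the double by the fundamental coweight at `i`, in the direction which increases
the modes of `x_i^±`. -/
def nodeShift : DoubleForm D →ₐ[ℂ[X]] DoubleForm D :=
  latticeShift D fun j => if i = j then ε else 0

theorem nodeShift_x (j : I) (r : ℕ) :
    nodeShift D ε i (toDoubleForm D (PolyAlg.gen D (.x ε j r))) =
      toDoubleForm D (PolyAlg.gen D (.x ε j (r + if i = j then 1 else 0))) := by
  rw [nodeShift, toDoubleForm_gen, toDoubleForm_gen, latticeShift_gen]
  congr 2
  simp only [Gen.mapMode, shiftGen, Gen.x.injEq, true_and]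
  split_ifs
  -- The coweight takes the value `ε` at `i`, and `x^ε` is moved by `ε` times it, hence up by one
  -- for either sign.
  · have : (ε : ℤ) * ε = 1 := by rw [← Units.val_mul, Int.units_mul_self, Units.val_one]
    simp [this]
  · simp

theorem nodeShift_h (j : I) (r : ℕ) :
    nodeShift D ε i (toDoubleForm D (PolyAlg.gen D (.h j r))) =
      toDoubleForm D (PolyAlg.gen D (.h j r)) := by
  rw [nodeShift, toDoubleForm_gen, latticeShift_gen]
  rfl

theorem nodeShift_car (y : 𝔥) :
    nodeShift D ε i (toDoubleForm D (PolyAlg.gen D (.car y))) =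
      toDoubleForm D (PolyAlg.gen D (.car y)) := by
  rw [nodeShift, toDoubleForm_gen, latticeShift_gen]
  rfl

/-- Modes of the sign `ε` only go up, hence stay natural numbers. Those of the opposite sign go
down, which is why the shift is restricted to a Borel subalgebra. -/
theorem nodeShift_mem (y : borel D ε) :
    nodeShift D ε i (toDoubleForm D y) ∈ (borel D ε).map (toDoubleForm D) := by
  suffices h : borel D ε ≤
      ((borel D ε).map (toDoubleForm D)).comap ((nodeShift D ε i).comp (toDoubleForm D)) from
    h y.2
  refine Algebra.adjoin_le ?_
  rintro _ ((⟨y, rfl⟩ | ⟨⟨j, r⟩, rfl⟩) | ⟨⟨j, r⟩, rfl⟩)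
  · exact ⟨_, (borel.car D ε y).2, (nodeShift_car D ε i y).symm⟩
  · exact ⟨_, (borel.x D ε j _).2, (nodeShift_x D ε i j r).symm⟩
  · exact ⟨_, (borel.h D ε j r).2, (nodeShift_h D ε i j r).symm⟩

/-- The shift endomorphism of a Borel subalgebra at the index `i`. -/
def borelShift : borel D ε →ₐ[ℂ[X]] borel D ε :=
  ((borel D ε).equivMapOfInjective _ (toDoubleForm_injective D)).symm.toAlgHom.comp
    ((((nodeShift D ε i).comp (toDoubleForm D)).comp (borel D ε).val).codRestrict _
      (nodeShift_mem D ε i))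

theorem toDoubleForm_borelShift (y : borel D ε) :
    toDoubleForm D (borelShift D ε i y) = nodeShift D ε i (toDoubleForm D y) :=
  congrArg Subtype.val (((borel D ε).equivMapOfInjective _
    (toDoubleForm_injective D)).apply_symm_apply ⟨_, nodeShift_mem D ε i y⟩)

theorem isShift_borelShift : IsShift D ε i (borelShift D ε i) where
  map_x j r := Subtype.ext (toDoubleForm_injective D
    ((toDoubleForm_borelShift D ε i _).trans (nodeShift_x D ε i j r)))
  map_h j r := Subtype.ext (toDoubleForm_injective D
    ((toDoubleForm_borelShift D ε i _).trans (nodeShift_h D ε i j r)))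
  map_car y := Subtype.ext (toDoubleForm_injective D
    ((toDoubleForm_borelShift D ε i _).trans (nodeShift_car D ε i y)))

theorem borelShift_injective : Function.Injective (borelShift D ε i) := by
  intro y y' h
  have := toDoubleForm_borelShift D ε i y
  rw [h, toDoubleForm_borelShift] at this
  exact Subtype.ext (toDoubleForm_injective D (latticeShift_injective D _ this.symm))

variable {D ε i}

theorem IsShift.unique {σ σ' : borel D ε →ₐ[ℂ[X]] borel D ε} (h : IsShift D ε i σ)
    (h' : IsShift D ε i σ') : σ' = σ := by
  have key : borel D ε ≤ (AlgHom.equalizer σ' σ).map (borel D ε).val := by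
    refine Algebra.adjoin_le ?_
    rintro _ ((⟨y, rfl⟩ | ⟨⟨j, r⟩, rfl⟩) | ⟨⟨j, r⟩, rfl⟩)
    · exact ⟨borel.car D ε y, (h'.map_car y).trans (h.map_car y).symm, rfl⟩
    · exact ⟨borel.x D ε j r, (h'.map_x j r).trans (h.map_x j r).symm, rfl⟩
    · exact ⟨borel.h D ε j r, (h'.map_h j r).trans (h.map_h j r).symm, rfl⟩
  refine AlgHom.ext fun y => ?_
  obtain ⟨z, hz, hzy⟩ := key y.2
  rw [← Subtype.ext hzy]
  exact hz

end BorelShift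

end KacMoodyYangian

end

theorem corollary4p4 {I : Type*} {𝔥 : Type*} [Fintype I] [DecidableEq I]
    [AddCommGroup 𝔥] [Module ℂ 𝔥] (D : KacMoodyYangian.Datum I 𝔥) :
    Function.Injective (KacMoodyYangian.toDoubleForm D) ∧
    Function.Injective (KacMoodyYangian.toDouble D) ∧
    ∀ (ε : ℤˣ) (i : I),
      ∃ σ : KacMoodyYangian.borel D ε →ₐ[ℂ[X]] KacMoodyYangian.borel D ε,
        KacMoodyYangian.IsShift D ε i σ ∧ Function.Injective σ ∧
        ∀ σ', KacMoodyYangian.IsShift D ε i σ' → σ' = σ :=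
  ⟨KacMoodyYangian.toDoubleForm_injective D, KacMoodyYangian.toDouble_injective D, fun ε i =>
    ⟨KacMoodyYangian.borelShift D ε i, KacMoodyYangian.isShift_borelShift D ε i,
      KacMoodyYangian.borelShift_injective D ε i, fun _ h' =>
        (KacMoodyYangian.isShift_borelShift D ε i).unique h'⟩⟩
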